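/- Let $\mathrm{Cvx}_0(\mathbb{R}^n)$ denote the class of lower semicontinuous convex functions $\varphi:\mathbb{R}^n\to[0,\infty]$ with $\varphi(0)=0$. For $\varphi\in\mathrm{Cvx}_0(\mathbb{R}^n)$ let \[ (\mathcal{L}\varphi)(y)=\sup_{x\in\mathbb{R}^n}\bigl(\langle x,y\rangle-\varphi(x)\bigr),\qquad (\mathcal{A}\varphi)(x)=\sup_{y\in\mathbb{R}^n}\frac{\langle x,y\rangle-1}{\varphi(y)} \] be the Legendre transform and the polarity transform, where in the second formula $(\mathcal{A}\varphi)(x)=+\infty$ if $\langle x,y\rangle>1$ for some $y$ with $\varphi(y)=0$, and otherwise the supremum is taken over those $y$ with $\varphi(y)>0$ (and is $0$ if there are none). Let $\mathcal{J}=\mathcal{A}\mathcal{L}$, and put \[ s^{\mathcal{J}}(\varphi)=\frac{\int_{\mathbb{R}^n}e^{-\mathcal{J}\varphi(x)}\,dx}{\int_{\mathbb{R}^n}e^{-\varphi(x)}\,dx}, \] with the conventions $e^{-\infty}=0$ and $\frac00=\frac{\infty}{\infty}=1$. Then there exist universal constants $c,C>0$ and $N\in\mathbb{N}$ such that for every $n\ge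 N$ the functional $s^{\mathcal{J}}$ attains a finite maximum on $\mathrm{Cvx}_0(\mathbb{R}^n)$, and \[ \left(1+\frac{c}{n}\right)n!\;\le\;\max_{\varphi\in\mathrm{Cvx}_0(\mathbb{R}^n)}s^{\mathcal{J}}(\varphi)\;\le\;\left(1+\frac{C}{n}\right)n!. \] -/

import Mathlib

open MeasureTheory
open scoped ENNReal NNReal

/-- `ℝⁿ` with its Euclidean structure. -/
abbrev Rn (n : ℕ) : Type := EuclideanSpace ℝ (Fin n)

/-- `Cvx₀(ℝⁿ)`: the lower semicontinuous convex functions `φ : ℝⁿ → [0, ∞]` with `φ 0 = 0`. -/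
def Cvx0 (n : ℕ) : Set (Rn n → ℝ≥0∞) :=
  {φ | ConvexOn ℝ≥0 Set.univ φ ∧ LowerSemicontinuous φ ∧ φ 0 = 0}

/-- The Legendre transform `(𝓛 φ)(y) = sup_x (⟨x, y⟩ - φ x)`. Since `φ 0 = 0`, the supremum is
at least `0` (take `x = 0`), so truncating each term at `0` does not change it. -/
noncomputable def legendre {n : ℕ} (φ : Rn n → ℝ≥0∞) : Rn n → ℝ≥0∞ :=
  fun y => ⨆ x : Rn n, (ENNReal.ofReal (inner ℝ x y) - φ x)

/-- The polarity transform `(𝓐 φ)(x) = sup_y (⟨x, y⟩ - 1) / φ y`, with the usual convention: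
a positive number over `0` is `∞`, points `y` with `φ y = 0` and `⟨x, y⟩ ≤ 1` do not contribute,
and the supremum of nothing is `0`. Thus `(𝓐 φ)(x) = ∞` when `x` is outside the polar of
`{φ = 0}`. For `φ` in `Cvx₀(ℝⁿ)` the transform is non-negative, so truncating the numerator
at `0` does not change it. -/
noncomputable def polarity {n : ℕ} (φ : Rn n → ℝ≥0∞) : Rn n → ℝ≥0∞ :=
  fun x => ⨆ y : Rn n, ENNReal.ofReal (inner ℝ x y - 1) / φ y

/-- The transform `𝓙 = 𝓐 𝓛`. -/
noncomputable def transformJ {n : ℕ} (φ : Rn n → ℝ≥0∞) : Rn n → ℝ≥0∞ :=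
  polarity (legendre φ)

/-- `∫ e^{-φ}` over `ℝⁿ` with Lebesgue measure, as an element of `[0, ∞]` (`e^{-∞} = 0`). -/
noncomputable def expIntegral {n : ℕ} (φ : Rn n → ℝ≥0∞) : ℝ≥0∞ :=
  ∫⁻ x : Rn n, EReal.exp (-(φ x : EReal))

open Classical in
/-- `s^𝓙(φ) = ∫ e^{-𝓙 φ} / ∫ e^{-φ}`, with the convention `0 / 0 = ∞ / ∞ = 1`. -/
noncomputable def sJ {n : ℕ} (φ : Rn n → ℝ≥0∞) : ℝ≥0∞ :=
  if (expIntegral (transformJ φ) = 0 ∧ expIntegral φ = 0) ∨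
      (expIntegral (transformJ φ) = ∞ ∧ expIntegral φ = ∞) then 1
  else expIntegral (transformJ φ) / expIntegral φ

open Set Filter Topology

/-! By Fenchel–Moreau, `𝓙 φ x ≤ r` iff `φ (x / r) ≤ 1 / r` (`transformJ_le_iff`). With `V(t) = |{φ ≤
t}|`, the layer-cake formula gives numerator `∫ e^{-r} r^n V(1/r) dr` and denominator `∫ e^{-t} V(t)
dt`. Here `V(t)` increases and, by convexity and `φ 0 = 0`, `V(t) / t^n` decreases.

Upper bound: for every `b > 0` the numerator is at most `(n! + b^{-n}) V(b)` and the denominator at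
least `e^{-b} V(b)`; take `b = 4/n` (`sJ_le`).

Lower bound: for `δ‖x‖` on the unit ball and `∞` outside, with `δ = 1/(4n)`, the numerator loses
exponentially little from `n! |B|`, while the denominator is `|B| (1 - δ)` up to lower-order terms
(`exists_le_sJ`).

Attainment: `s^𝓙` is invariant under invertible linear maps, so in a maximizing sequence `{φ ≤ 1}`
can be held between a fixed simplex and a fixed ball (`exists_normalized`). A subsequence of
epigraphs then converges almost everywhere, and both integrals, being measures of the epigraph, pass
to the limit (`exists_limit`). -/

variable {n : ℕ}

/-! ### Epigraphs, Fenchel–Moreau duality and the pointwise form of `𝓙`. -/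

/-- The epigraph of `φ`, as a subset of `ℝⁿ × ℝ`. -/
def epi (φ : Rn n → ℝ≥0∞) : Set (Rn n × ℝ) :=
  {p | φ p.1 ≤ ENNReal.ofReal p.2 ∧ 0 ≤ p.2}

lemma epi_le_toReal {φ : Rn n → ℝ≥0∞} {x : Rn n} (h : φ x ≠ ∞) : (x, (φ x).toReal) ∈ epi φ := by
  simp [epi, ENNReal.ofReal_toReal h]

lemma isClosed_epi {φ : Rn n → ℝ≥0∞} (h : LowerSemicontinuous φ) : IsClosed (epi φ) := by
  have h1 : IsClosed {p : Rn n × ℝ≥0∞ | φ p.1 ≤ p.2} := h.isClosed_epigraph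
  have h2 : Continuous fun p : Rn n × ℝ => (p.1, ENNReal.ofReal p.2) :=
    continuous_fst.prodMk (ENNReal.continuous_ofReal.comp continuous_snd)
  exact (h1.preimage h2).inter (isClosed_le continuous_const continuous_snd)

lemma convex_epi {φ : Rn n → ℝ≥0∞} (h : ConvexOn ℝ≥0 univ φ) : Convex ℝ (epi φ) := by
  rintro ⟨x, s⟩ ⟨hx, hs⟩ ⟨y, t⟩ ⟨hy, ht⟩ a b ha hb hab
  simp only at hx hs hy ht
  refine ⟨?_, by simp only [Prod.snd_add, Prod.smul_snd, smul_eq_mul]; positivity⟩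
  lift a to ℝ≥0 using ha
  lift b to ℝ≥0 using hb
  have := h.2 (mem_univ x) (mem_univ y) (zero_le (a := a)) (zero_le (a := b)) (by exact_mod_cast hab)
  refine le_trans (le_of_eq ?_) (this.trans ?_)
  · rfl
  · simp only [Prod.snd_add, Prod.smul_snd, smul_eq_mul]
    rw [ENNReal.ofReal_add (by positivity) (by positivity), ENNReal.ofReal_mul a.coe_nonneg,
      ENNReal.ofReal_mul b.coe_nonneg, ENNReal.ofReal_coe_nnreal, ENNReal.ofReal_coe_nnreal]
    simp only [ENNReal.smul_def, smul_eq_mul]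
    gcongr

lemma inner_sub_legendre_le (φ : Rn n → ℝ≥0∞) (x y : Rn n) :
    ENNReal.ofReal (inner ℝ x y) - legendre φ y ≤ φ x := by
  have : ENNReal.ofReal (inner ℝ x y) - φ x ≤ legendre φ y :=
    le_iSup (fun x : Rn n => ENNReal.ofReal (inner ℝ x y) - φ x) x
  rw [tsub_le_iff_right] at this ⊢
  rwa [add_comm]

/-- The Fenchel–Moreau theorem, for non-negative functions. -/
lemma le_of_forall_inner_sub_legendre_le {φ : Rn n → ℝ≥0∞} (hφ : φ ∈ Cvx0 n) {x₀ : Rn n} {s : ℝ}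
    (hs : 0 ≤ s)
    (h : ∀ y, ENNReal.ofReal (inner ℝ x₀ y) - legendre φ y ≤ ENNReal.ofReal s) :
    φ x₀ ≤ ENNReal.ofReal s := by
  obtain ⟨hc, hl, h0⟩ := hφ
  by_contra hcon
  have hnot : (x₀, s) ∉ epi φ := fun h => hcon h.1
  obtain ⟨f, u, hfu, hf⟩ := geometric_hahn_banach_point_closed (convex_epi hc) (isClosed_epi hl) hnot
  set w : Rn n := (InnerProductSpace.toDual ℝ (Rn n)).symm (f.comp (ContinuousLinearMap.inl ℝ _ _))
    with hw
  set σ : ℝ := f (0, 1) with hσ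
  have hfe : ∀ x t, f (x, t) = inner ℝ x w + t * σ := by
    intro x t
    rw [real_inner_comm, hw, InnerProductSpace.toDual_symm_apply]
    have : ((x, t) : Rn n × ℝ) = (x, 0) + t • (0, 1) := by ext <;> simp
    rw [this, map_add, map_smul]
    simp [hσ]
  have hup : ∀ T : ℝ, 0 ≤ T → u < T * σ := by
    intro T hT
    have := hf (0, T) ⟨by simp [h0], hT⟩
    simpa [hfe] using this
  have hu0 : u < 0 := by simpa using hup 0 le_rfl
  have hσ0 : 0 ≤ σ := by
    by_contra hneg
    push Not at hneg
    have := hup (u / σ) (by rw [div_nonneg_iff]; right; constructor <;> linarith)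
    rw [div_mul_cancel₀ _ hneg.ne] at this
    exact lt_irrefl _ this
  rw [hfe] at hfu
  -- For `σ > 0` rescale the functional to slope `1` in the height. A vertical hyperplane (`σ = 0`)
  -- is scaled until it beats `s`. As heights are non-negative, `l * σ ≤ 1` suffices below.
  obtain ⟨l, hl0, hlσ, hls⟩ : ∃ l : ℝ, 0 < l ∧ l * σ ≤ 1 ∧ s < l * (u - inner ℝ x₀ w) := by
    rcases hσ0.eq_or_lt with h' | h'
    · rw [← h'] at hfu
      have hp : 0 < u - inner ℝ x₀ w := by linarith
      refine ⟨(s + 1) / (u - inner ℝ x₀ w), by positivity, by rw [← h']; simp, ?_⟩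
      rw [div_mul_cancel₀ _ hp.ne']
      linarith
    · refine ⟨σ⁻¹, by positivity, by rw [inv_mul_cancel₀ h'.ne'], ?_⟩
      rw [inv_mul_eq_div, lt_div_iff₀ h']
      linarith
  have hL : legendre φ (-l • w) ≤ ENNReal.ofReal (-(l * u)) := by
    refine iSup_le fun x => ?_
    by_cases hx : φ x = ∞
    · simp [hx]
    have hm := hf _ (epi_le_toReal hx)
    rw [hfe] at hm
    have ht : 0 ≤ (φ x).toReal := ENNReal.toReal_nonneg
    rw [← ENNReal.ofReal_toReal hx, ← ENNReal.ofReal_sub _ ht]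
    apply ENNReal.ofReal_le_ofReal
    rw [inner_smul_right]
    nlinarith
  have h1 := h (-l • w)
  have h2 : ENNReal.ofReal (inner ℝ x₀ (-l • w)) - ENNReal.ofReal (-(l * u)) ≤ ENNReal.ofReal s :=
    (tsub_le_tsub_left hL _).trans h1
  rw [← ENNReal.ofReal_sub _ (by nlinarith), ENNReal.ofReal_le_ofReal_iff hs, inner_smul_right] at h2
  linarith

/-- Pointwise description of `𝓙`. -/
lemma transformJ_le_iff {φ : Rn n → ℝ≥0∞} (hφ : φ ∈ Cvx0 n) (x : Rn n) {r : ℝ} (hr : 0 < r) :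
    transformJ φ x ≤ ENNReal.ofReal r ↔ φ (r⁻¹ • x) ≤ ENNReal.ofReal r⁻¹ := by
  -- With `a = ⟨x, y⟩` and `L = 𝓛 φ y` finite, both sides say `a - 1 ≤ r L`. So the left side of the
  -- lemma bounds the biconjugate of `φ` at `x / r`.
  have key : ∀ y, ENNReal.ofReal (inner ℝ x y - 1) / legendre φ y ≤ ENNReal.ofReal r ↔
      ENNReal.ofReal (inner ℝ (r⁻¹ • x) y) - legendre φ y ≤ ENNReal.ofReal r⁻¹ := by
    intro y
    rw [inner_smul_left]
    simp only [conj_trivial]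
    generalize inner ℝ x y = a
    rcases eq_or_ne (legendre φ y) ∞ with hL | hL
    · simp [hL]
    lift legendre φ y to ℝ≥0 using hL with L
    rw [← ENNReal.ofReal_coe_nnreal, ← ENNReal.ofReal_sub _ L.coe_nonneg,
      ENNReal.ofReal_le_ofReal_iff (by positivity)]
    rcases eq_or_ne L 0 with h0 | h0
    · rcases le_or_gt a 1 with ha | ha
      · simp only [h0, ENNReal.ofReal_of_nonpos (sub_nonpos.2 ha)]
        simp only [ENNReal.zero_div, zero_le, true_iff, NNReal.coe_zero, sub_zero]
        nlinarith [inv_pos.2 hr]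
      · have : ENNReal.ofReal (a - 1) ≠ 0 := by simpa using ha
        simp only [h0, NNReal.coe_zero, ENNReal.ofReal_zero, ENNReal.div_zero this, sub_zero]
        simp only [top_le_iff, ENNReal.ofReal_ne_top, false_iff, not_le]
        nlinarith [inv_pos.2 hr]
    · have hL : (0 : ℝ) < L := by positivity
      rw [← ENNReal.ofReal_div_of_pos hL, ENNReal.ofReal_le_ofReal_iff hr.le, div_le_iff₀ hL]
      have e : r⁻¹ * a - L = r⁻¹ * (a - r * L) := by field_simp
      have e2 : r⁻¹ = r⁻¹ * 1 := by simp
      rw [e]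
      conv_rhs => rhs; rw [e2]
      rw [mul_le_mul_iff_right₀ (inv_pos.2 hr)]
      constructor <;> intro h <;> linarith
  constructor
  · intro h
    refine le_of_forall_inner_sub_legendre_le hφ (by positivity) fun y => ?_
    rw [← key]
    exact (le_iSup (fun y => ENNReal.ofReal (inner ℝ x y - 1) / legendre φ y) y).trans h
  · intro h
    refine iSup_le fun y => ?_
    rw [key]
    exact (inner_sub_legendre_le _ _ _).trans h

/-! ### Layer-cake formulas for the two integrals. -/

/-- The volume of a sublevel set. -/
noncomputable def levelVol (φ : Rn n → ℝ≥0∞) (t : ℝ) : ℝ≥0∞ :=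
  volume {x | φ x ≤ ENNReal.ofReal t}

lemma exp_neg_eq_lintegral (a : ℝ≥0∞) : EReal.exp (-(a : EReal)) =
    ∫⁻ t in Ioi (0 : ℝ), {t : ℝ | a ≤ ENNReal.ofReal t}.indicator
      (fun t => ENNReal.ofReal (Real.exp (-t))) t := by
  rcases eq_or_ne a ∞ with h | h
  · simp [h]
  lift a to ℝ≥0 using h
  have hm : MeasurableSet {t : ℝ | (a : ℝ≥0∞) ≤ ENNReal.ofReal t} :=
    measurableSet_le measurable_const ENNReal.measurable_ofReal
  rw [lintegral_indicator hm, Measure.restrict_restrict hm]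
  have hset : ({t : ℝ | (a : ℝ≥0∞) ≤ ENNReal.ofReal t} ∩ Ioi 0 : Set ℝ) =ᵐ[volume] Ioi (a : ℝ) := by
    refine EventuallyEq.trans (g := Ici (a : ℝ)) ?_ Ioi_ae_eq_Ici.symm
    have h0 : ∀ᵐ t : ℝ, t ≠ 0 := by simp [ae_iff]
    filter_upwards [h0] with t ht
    apply propext
    change ((a : ℝ≥0∞) ≤ ENNReal.ofReal t ∧ 0 < t) ↔ (a : ℝ) ≤ t
    constructor
    · rintro ⟨h1, h2⟩
      rwa [← ENNReal.ofReal_coe_nnreal, ENNReal.ofReal_le_ofReal_iff h2.le] at h1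
    · intro h1
      have h2 : 0 ≤ t := a.2.trans h1
      refine ⟨?_, lt_of_le_of_ne h2 ht.symm⟩
      rwa [← ENNReal.ofReal_coe_nnreal, ENNReal.ofReal_le_ofReal_iff h2]
  rw [Measure.restrict_congr_set hset, ← ofReal_integral_eq_lintegral_ofReal, integral_exp_neg_Ioi]
  · have : -((a : ℝ≥0∞) : EReal) = ((-(a : ℝ) : ℝ) : EReal) := by
      rw [EReal.coe_neg]; rfl
    rw [this, EReal.exp_coe]
  · exact integrableOn_exp_neg_Ioi _
  · exact ae_of_all _ fun t => (Real.exp_pos _).le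

lemma expIntegral_eq_lintegral {ψ : Rn n → ℝ≥0∞} (hψ : Measurable ψ) :
    expIntegral ψ = ∫⁻ t in Ioi (0 : ℝ), ENNReal.ofReal (Real.exp (-t)) * levelVol ψ t := by
  unfold expIntegral
  simp_rw [exp_neg_eq_lintegral]
  rw [lintegral_lintegral_swap]
  · refine lintegral_congr fun t => ?_
    have hm : MeasurableSet {x | ψ x ≤ ENNReal.ofReal t} := measurableSet_le hψ measurable_const
    rw [levelVol, ← setLIntegral_const, ← lintegral_indicator hm]
    rfl
  · have hm : MeasurableSet {p : Rn n × ℝ | ψ p.1 ≤ ENNReal.ofReal p.2} :=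
      measurableSet_le (by fun_prop) (by fun_prop)
    have : Measurable ({p : Rn n × ℝ | ψ p.1 ≤ ENNReal.ofReal p.2}.indicator
      (fun p => ENNReal.ofReal (Real.exp (-p.2)))) := Measurable.indicator (by fun_prop) hm
    exact this.aemeasurable

/-- Restricted to positive finite heights, the range of `transformJ_le_iff`. -/
lemma measurable_of_measurableSet_le_ofReal {ψ : Rn n → ℝ≥0∞}
    (h : ∀ r : ℝ, 0 < r → MeasurableSet {x | ψ x ≤ ENNReal.ofReal r}) : Measurable ψ := by
  refine measurable_of_Iic fun a => ?_
  rcases eq_or_ne a ∞ with ha | ha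
  · simp [ha]
  have : ψ ⁻¹' Iic a = ⋂ k : ℕ, {x | ψ x ≤ ENNReal.ofReal (a.toReal + 1 / ((k : ℝ) + 1))} := by
    ext x
    simp only [mem_preimage, mem_Iic, mem_iInter, mem_ofPred_eq]
    constructor
    · intro hx k
      rw [← ENNReal.ofReal_toReal ha] at hx
      exact hx.trans (ENNReal.ofReal_le_ofReal (by simp; positivity))
    · intro hx
      have hlim : Tendsto (fun k : ℕ => ENNReal.ofReal (a.toReal + 1 / ((k : ℝ) + 1))) atTop
          (𝓝 (ENNReal.ofReal (a.toReal + 0))) :=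
        ENNReal.tendsto_ofReal (tendsto_const_nhds.add tendsto_one_div_add_atTop_nhds_zero_nat)
      rw [add_zero, ENNReal.ofReal_toReal ha] at hlim
      exact ge_of_tendsto' hlim hx
  rw [this]
  exact MeasurableSet.iInter fun k => h _ (by positivity)

lemma measurable_transformJ {φ : Rn n → ℝ≥0∞} (hφ : φ ∈ Cvx0 n) : Measurable (transformJ φ) := by
  refine measurable_of_measurableSet_le_ofReal fun r hr => ?_
  simp_rw [transformJ_le_iff hφ _ hr]
  exact measurableSet_le (hφ.2.1.measurable.comp (measurable_const_smul _)) measurable_const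

/-- `{𝓙 φ ≤ r}` is the dilate by `r` of `{φ ≤ 1/r}`, whence the factor `r ^ n`. -/
lemma expIntegral_transformJ {φ : Rn n → ℝ≥0∞} (hφ : φ ∈ Cvx0 n) :
    expIntegral (transformJ φ) = ∫⁻ r in Ioi (0 : ℝ),
      ENNReal.ofReal (Real.exp (-r)) * (ENNReal.ofReal (r ^ n) * levelVol φ r⁻¹) := by
  rw [expIntegral_eq_lintegral (measurable_transformJ hφ)]
  refine setLIntegral_congr_fun measurableSet_Ioi fun r hr => ?_
  have hr : 0 < r := hr
  congr 1
  unfold levelVol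
  simp_rw [transformJ_le_iff hφ _ hr]
  have := Measure.addHaar_preimage_smul (volume : Measure (Rn n)) (inv_pos.2 hr).ne'
    {x | φ x ≤ ENNReal.ofReal r⁻¹}
  rw [preimage_ofPred_eq] at this
  rw [this]
  simp only [inv_pow, inv_inv, finrank_euclideanSpace, Fintype.card_fin]
  rw [abs_of_nonneg (by positivity)]

lemma lintegral_Ioi_inv (g : ℝ → ℝ≥0∞) : ∫⁻ r in Ioi (0 : ℝ), g r =
    ∫⁻ t in Ioi (0 : ℝ), ENNReal.ofReal ((t ^ 2)⁻¹) * g t⁻¹ := by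
  have himg : (fun t : ℝ => t⁻¹) '' Ioi 0 = Ioi 0 := by
    ext x
    simp only [image_inv_eq_inv, Set.mem_inv, mem_Ioi, inv_pos]
  conv_lhs => rw [← himg]
  rw [lintegral_image_eq_lintegral_abs_deriv_mul measurableSet_Ioi
    (fun t ht => (hasDerivAt_inv (ne_of_gt ht)).hasDerivWithinAt) (inv_injective.injOn)]
  refine setLIntegral_congr_fun measurableSet_Ioi fun t ht => ?_
  have ht : 0 < t := ht
  rw [abs_neg, abs_of_nonneg (by positivity)]

/-! ### Growth of level volumes and the degenerate cases. -/

lemma levelVol_mono (φ : Rn n → ℝ≥0∞) : Monotone (levelVol φ) := fun _ _ hst =>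
  measure_mono fun _ hx => le_trans hx (ENNReal.ofReal_le_ofReal hst)

lemma apply_smul_le {φ : Rn n → ℝ≥0∞} (hφ : φ ∈ Cvx0 n) {c : ℝ} (hc0 : 0 ≤ c) (hc1 : c ≤ 1)
    (x : Rn n) : φ (c • x) ≤ ENNReal.ofReal c * φ x := by
  lift c to ℝ≥0 using hc0
  have hc1 : c ≤ 1 := by exact_mod_cast hc1
  have := hφ.1.2 (mem_univ x) (mem_univ 0) (zero_le (a := c)) (zero_le (a := 1 - c))
    (add_tsub_cancel_of_le hc1)
  rw [smul_zero, add_zero, hφ.2.2, smul_zero, add_zero, ENNReal.smul_def, smul_eq_mul] at this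
  rwa [ENNReal.ofReal_coe_nnreal]

/-- Contracting `{φ ≤ t}` by `s / t` lands in `{φ ≤ s}`. -/
lemma levelVol_le_scale {φ : Rn n → ℝ≥0∞} (hφ : φ ∈ Cvx0 n) {s t : ℝ} (hs : 0 < s) (hst : s ≤ t) :
    levelVol φ t ≤ ENNReal.ofReal ((t / s) ^ n) * levelVol φ s := by
  have ht : 0 < t := hs.trans_le hst
  have h := Measure.addHaar_preimage_smul (volume : Measure (Rn n)) (div_pos hs ht).ne'
    {x | φ x ≤ ENNReal.ofReal s}
  rw [finrank_euclideanSpace, Fintype.card_fin, ← inv_pow, inv_div,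
    abs_of_nonneg (by positivity)] at h
  unfold levelVol
  rw [← h]
  refine measure_mono fun x (hx : φ x ≤ ENNReal.ofReal t) => ?_
  refine (apply_smul_le hφ (by positivity) ((div_le_one ht).2 hst) x).trans ?_
  calc ENNReal.ofReal (s / t) * φ x ≤ ENNReal.ofReal (s / t) * ENNReal.ofReal t := by gcongr
    _ = ENNReal.ofReal s := by
      rw [← ENNReal.ofReal_mul (by positivity), div_mul_cancel₀ _ ht.ne']

/-- Together with `levelVol_eq_top`: degeneracy at one height spreads to all positive heights, which
forces the `0/0` or `∞/∞` convention. -/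
lemma levelVol_eq_zero {φ : Rn n → ℝ≥0∞} (hφ : φ ∈ Cvx0 n) {s t : ℝ} (hs : 0 < s)
    (h : levelVol φ s = 0) : levelVol φ t = 0 := by
  rcases le_total t s with hts | hts
  · exact le_antisymm (h ▸ levelVol_mono φ hts) (zero_le)
  · have := levelVol_le_scale hφ hs hts
    rw [h, mul_zero] at this
    exact le_antisymm this (zero_le)

lemma levelVol_eq_top {φ : Rn n → ℝ≥0∞} (hφ : φ ∈ Cvx0 n) {s t : ℝ} (ht : 0 < t)
    (h : levelVol φ s = ∞) : levelVol φ t = ∞ := by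
  rcases le_total s t with hts | hts
  · exact top_le_iff.1 (h ▸ levelVol_mono φ hts)
  · have := levelVol_le_scale hφ ht hts
    rw [h, top_le_iff, ENNReal.mul_eq_top] at this
    rcases this with h | h
    · exact h.2
    · exact absurd h.1 ENNReal.ofReal_ne_top

lemma measurable_of_mem_cvx0 {φ : Rn n → ℝ≥0∞} (hφ : φ ∈ Cvx0 n) : Measurable φ :=
  hφ.2.1.measurable

lemma sJ_eq_one_of_levelVol_eq_zero {φ : Rn n → ℝ≥0∞} (hφ : φ ∈ Cvx0 n) {s : ℝ} (hs : 0 < s)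
    (h : levelVol φ s = 0) : sJ φ = 1 := by
  refine if_pos (Or.inl ⟨?_, ?_⟩)
  · rw [expIntegral_transformJ hφ]
    simp [levelVol_eq_zero hφ hs h]
  · rw [expIntegral_eq_lintegral (measurable_of_mem_cvx0 hφ)]
    simp [levelVol_eq_zero hφ hs h]

lemma sJ_eq_one_of_levelVol_eq_top {φ : Rn n → ℝ≥0∞} (hφ : φ ∈ Cvx0 n) {s : ℝ}
    (h : levelVol φ s = ∞) : sJ φ = 1 := by
  have key : ∀ f : ℝ → ℝ≥0∞, (∀ t, 0 < t → f t = ∞) → ∫⁻ t in Ioi (0 : ℝ), f t = ∞ := by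
    intro f hf
    rw [setLIntegral_congr_fun (g := fun _ => ∞) measurableSet_Ioi fun t ht => hf t ht]
    simp
  refine if_pos (Or.inr ⟨?_, ?_⟩)
  · rw [expIntegral_transformJ hφ]
    refine key _ fun t ht => ?_
    rw [levelVol_eq_top hφ (inv_pos.2 ht) h, ENNReal.mul_top, ENNReal.mul_top]
    · simpa using Real.exp_pos _
    · simpa using pow_pos ht n
  · rw [expIntegral_eq_lintegral (measurable_of_mem_cvx0 hφ)]
    refine key _ fun t ht => ?_
    rw [levelVol_eq_top hφ ht h, ENNReal.mul_top]
    simpa using Real.exp_pos _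

/-! ### The upper bound. -/

lemma integrableOn_exp_neg_mul_pow (m : ℕ) :
    IntegrableOn (fun r : ℝ => Real.exp (-r) * r ^ m) (Ioi 0) := by
  have := Real.GammaIntegral_convergent (s := m + 1) (by positivity)
  simpa using this

lemma lintegral_exp_neg_mul_pow (m : ℕ) :
    ∫⁻ r in Ioi (0 : ℝ), ENNReal.ofReal (Real.exp (-r) * r ^ m) = ENNReal.ofReal m.factorial := by
  rw [← ofReal_integral_eq_lintegral_ofReal (integrableOn_exp_neg_mul_pow m)]
  · rw [← Real.Gamma_nat_eq_factorial, Real.Gamma_eq_integral (by positivity)]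
    simp
  · refine (ae_restrict_iff' measurableSet_Ioi).2 (ae_of_all _ fun r hr => ?_)
    have : 0 < r := hr
    positivity

lemma lintegral_exp_neg : ∫⁻ r in Ioi (0 : ℝ), ENNReal.ofReal (Real.exp (-r)) = 1 := by
  simpa using lintegral_exp_neg_mul_pow 0

/-- Monotonicity handles `1/r ≤ b` and scaling handles `1/r ≥ b`; the sum covers both regimes and
integrates to `n! + b^{-n}`. -/
lemma pow_mul_levelVol_inv_le {φ : Rn n → ℝ≥0∞} (hφ : φ ∈ Cvx0 n) {b r : ℝ} (hb : 0 < b)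
    (hr : 0 < r) : ENNReal.ofReal (r ^ n) * levelVol φ r⁻¹ ≤
      (ENNReal.ofReal (r ^ n) + ENNReal.ofReal (b⁻¹ ^ n)) * levelVol φ b := by
  rcases le_total r⁻¹ b with h | h
  · calc _ ≤ ENNReal.ofReal (r ^ n) * levelVol φ b := by gcongr; exact levelVol_mono φ h
      _ ≤ _ := by gcongr; exact le_self_add
  · calc _ ≤ ENNReal.ofReal (r ^ n) * (ENNReal.ofReal ((r⁻¹ / b) ^ n) * levelVol φ b) := by
          gcongr; exact levelVol_le_scale hφ hb h
      _ = ENNReal.ofReal (b⁻¹ ^ n) * levelVol φ b := by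
          rw [← mul_assoc, ← ENNReal.ofReal_mul (by positivity), ← mul_pow]
          congr 3
          field_simp
      _ ≤ _ := by gcongr; exact le_add_self

lemma lintegral_exp_neg_mul_add (m : ℕ) {a : ℝ} (ha : 0 ≤ a) :
    ∫⁻ r in Ioi (0 : ℝ), ENNReal.ofReal (Real.exp (-r)) *
      (ENNReal.ofReal (r ^ m) + ENNReal.ofReal a) = ENNReal.ofReal (m.factorial + a) := by
  simp_rw [mul_add]
  rw [lintegral_add_left (by fun_prop), lintegral_mul_const _ (by fun_prop), lintegral_exp_neg,
    one_mul, ENNReal.ofReal_add (by positivity) ha, ← lintegral_exp_neg_mul_pow]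
  congr 1
  refine lintegral_congr fun r => ?_
  rw [ENNReal.ofReal_mul (Real.exp_pos _).le]

lemma expIntegral_transformJ_le {φ : Rn n → ℝ≥0∞} (hφ : φ ∈ Cvx0 n) {b : ℝ} (hb : 0 < b) :
    expIntegral (transformJ φ) ≤ ENNReal.ofReal (n.factorial + b⁻¹ ^ n) * levelVol φ b := by
  rw [expIntegral_transformJ hφ, ← lintegral_exp_neg_mul_add n (by positivity),
    ← lintegral_mul_const _ (by fun_prop)]
  refine setLIntegral_mono' measurableSet_Ioi fun r hr => ?_
  rw [mul_assoc]
  refine mul_le_mul' le_rfl ?_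
  exact pow_mul_levelVol_inv_le hφ hb hr

lemma lintegral_Ioi_exp_neg (b : ℝ) :
    ∫⁻ t in Ioi b, ENNReal.ofReal (Real.exp (-t)) = ENNReal.ofReal (Real.exp (-b)) := by
  rw [← ofReal_integral_eq_lintegral_ofReal (integrableOn_exp_neg_Ioi b)
    (ae_of_all _ fun t => (Real.exp_pos _).le), integral_exp_neg_Ioi]

lemma le_expIntegral {φ : Rn n → ℝ≥0∞} (hφ : φ ∈ Cvx0 n) {b : ℝ} (hb : 0 < b) :
    ENNReal.ofReal (Real.exp (-b)) * levelVol φ b ≤ expIntegral φ := by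
  rw [expIntegral_eq_lintegral (measurable_of_mem_cvx0 hφ), ← lintegral_Ioi_exp_neg,
    ← lintegral_mul_const _ (by fun_prop)]
  refine le_trans ?_ (lintegral_mono_set (Ioi_subset_Ioi hb.le))
  refine setLIntegral_mono' measurableSet_Ioi fun r hr => ?_
  gcongr
  exact levelVol_mono φ (le_of_lt hr)

lemma expIntegral_ne_zero {φ : Rn n → ℝ≥0∞} (hφ : φ ∈ Cvx0 n) {b : ℝ} (hb : 0 < b)
    (h : levelVol φ b ≠ 0) : expIntegral φ ≠ 0 := by
  refine (lt_of_lt_of_le ?_ (le_expIntegral hφ hb)).ne'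
  exact ENNReal.mul_pos (by simpa using Real.exp_pos _) h

/-- `V` grows at most like `t ^ n`, which `e^{-t}` integrates. -/
lemma expIntegral_ne_top {φ : Rn n → ℝ≥0∞} (hφ : φ ∈ Cvx0 n) {b : ℝ} (hb : 0 < b)
    (h : levelVol φ b ≠ ∞) : expIntegral φ ≠ ∞ := by
  rw [expIntegral_eq_lintegral (measurable_of_mem_cvx0 hφ)]
  have hle : ∀ t ∈ Ioi (0 : ℝ), ENNReal.ofReal (Real.exp (-t)) * levelVol φ t ≤
      ENNReal.ofReal (Real.exp (-t)) *
        (ENNReal.ofReal (t ^ n) + ENNReal.ofReal (b ^ n)) *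
        (ENNReal.ofReal (b⁻¹ ^ n) * levelVol φ b) := by
    intro t ht
    have ht : 0 < t := ht
    rw [mul_assoc]
    gcongr
    rw [← mul_assoc, add_mul, ← ENNReal.ofReal_mul (by positivity),
      ← ENNReal.ofReal_mul (by positivity), ← mul_pow, ← mul_pow, mul_inv_cancel₀ hb.ne', one_pow,
      ENNReal.ofReal_one]
    rcases le_total t b with h' | h'
    · calc levelVol φ t ≤ 1 * levelVol φ b := by rw [one_mul]; exact levelVol_mono φ h'
        _ ≤ _ := by gcongr; exact le_add_self
    · refine (levelVol_le_scale hφ hb h').trans ?_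
      rw [div_eq_mul_inv]
      gcongr
      exact le_self_add
  refine ne_top_of_le_ne_top ?_ (setLIntegral_mono' measurableSet_Ioi hle)
  rw [lintegral_mul_const _ (by fun_prop), lintegral_exp_neg_mul_add n (by positivity)]
  exact ENNReal.mul_ne_top ENNReal.ofReal_ne_top (ENNReal.mul_ne_top ENNReal.ofReal_ne_top h)

lemma sJ_eq_div {φ : Rn n → ℝ≥0∞} (hφ : φ ∈ Cvx0 n) {b : ℝ} (hb : 0 < b)
    (h0 : levelVol φ b ≠ 0) (h1 : levelVol φ b ≠ ∞) :
    sJ φ = expIntegral (transformJ φ) / expIntegral φ := by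
  refine if_neg ?_
  simp [expIntegral_ne_zero hφ hb h0, expIntegral_ne_top hφ hb h1]

lemma sJ_le_max {φ : Rn n → ℝ≥0∞} (hφ : φ ∈ Cvx0 n) {b : ℝ} (hb : 0 < b) :
    sJ φ ≤ max 1 (ENNReal.ofReal (Real.exp b * (n.factorial + b⁻¹ ^ n))) := by
  by_cases h0 : levelVol φ b = 0
  · rw [sJ_eq_one_of_levelVol_eq_zero hφ hb h0]; exact le_max_left _ _
  by_cases h1 : levelVol φ b = ∞
  · rw [sJ_eq_one_of_levelVol_eq_top hφ h1]; exact le_max_left _ _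
  rw [sJ_eq_div hφ hb h0 h1]
  refine le_trans ?_ (le_max_right _ _)
  refine ENNReal.div_le_of_le_mul ((expIntegral_transformJ_le hφ hb).trans ?_)
  calc _ = ENNReal.ofReal (Real.exp b * (n.factorial + b⁻¹ ^ n)) *
        (ENNReal.ofReal (Real.exp (-b)) * levelVol φ b) := by
        rw [← mul_assoc, ← ENNReal.ofReal_mul (by positivity)]
        congr 2
        rw [Real.exp_neg]
        field_simp
    _ ≤ _ := by gcongr; exact le_expIntegral hφ hb

/-- `n^n / n! ≤ e^n ≤ 3^n`, and Bernoulli for `(4/3)^n` gives `(3/4)^n ≤ 3/n`. -/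
lemma inv_four_div_pow_le {n : ℕ} (hn : 1 ≤ n) :
    ((4 / n : ℝ)⁻¹) ^ n ≤ 3 / n * n.factorial := by
  have hn0 : (0 : ℝ) < n := by exact_mod_cast hn
  have h1 : (n : ℝ) ^ n / n.factorial ≤ 3 ^ n := by
    refine (Real.pow_div_factorial_le_exp n hn0.le n).trans ?_
    rw [← Real.exp_one_pow]
    exact pow_le_pow_left₀ (Real.exp_pos _).le (by linarith [Real.exp_one_lt_d9]) _
  have h2 : 1 + (n : ℝ) * (1 / 3) ≤ (1 + 1 / 3) ^ n :=
    one_add_mul_le_pow (by norm_num) n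
  rw [div_le_iff₀ (by positivity)] at h1
  have h3 : (n : ℝ) * 3 ^ n ≤ 3 * 4 ^ n := by
    have : (4 : ℝ) ^ n = (1 + 1 / 3) ^ n * 3 ^ n := by rw [← mul_pow]; norm_num
    rw [this]
    nlinarith [pow_pos (show (0 : ℝ) < 3 by norm_num) n]
  rw [inv_div, div_pow, div_mul_eq_mul_div, div_le_div_iff₀ (by positivity) hn0]
  calc (n : ℝ) ^ n * n ≤ 3 ^ n * n.factorial * n := by gcongr
    _ = (n * 3 ^ n) * n.factorial := by ring
    _ ≤ (3 * 4 ^ n) * n.factorial := by gcongr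
    _ = _ := by ring

lemma sJ_le {φ : Rn n → ℝ≥0∞} (hφ : φ ∈ Cvx0 n) (hn : 4 ≤ n) :
    sJ φ ≤ ENNReal.ofReal ((1 + 35 / (n : ℝ)) * n.factorial) := by
  have hn4 : (4 : ℝ) ≤ n := by exact_mod_cast hn
  have hn0 : (0 : ℝ) < n := by linarith
  have hf : (1 : ℝ) ≤ n.factorial := by exact_mod_cast n.factorial_pos
  -- At `b = 4/n` both losses are `O(1/n)`: the factor `e^b`, and `b^{-n}` relative to `n!`.
  refine (sJ_le_max hφ (b := 4 / n) (by positivity)).trans (max_le ?_ ?_)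
  · rw [ENNReal.one_le_ofReal]
    nlinarith [show 0 < 35 / (n : ℝ) by positivity]
  · apply ENNReal.ofReal_le_ofReal
    have h4 : 4 / (n : ℝ) ≤ 1 := (div_le_one hn0).2 hn4
    have hexp : Real.exp (4 / n) ≤ 1 + 2 * (4 / n) := by
      have := Real.abs_exp_sub_one_le (x := 4 / (n : ℝ)) (by rwa [abs_of_pos (by positivity)])
      rw [abs_of_pos (show 0 < 4 / (n : ℝ) by positivity)] at this
      linarith [le_abs_self (Real.exp (4 / (n : ℝ)) - 1)]
    have h3 := inv_four_div_pow_le (n := n) (by omega)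
    set i : ℝ := 1 / n with hi
    have e : ∀ c : ℝ, c / (n : ℝ) = c * i := fun c => by rw [hi]; ring
    rw [e] at *
    have hi0 : 0 < i := by positivity
    calc _ ≤ (1 + 2 * (4 * i)) * (n.factorial + 3 / n * n.factorial) := by gcongr
      _ = ((1 + 2 * (4 * i)) * (1 + 3 * i)) * n.factorial := by rw [e]; ring
      -- `(1 + 8i)(1 + 3i) = 1 + 11i + 24i²`, and `i ≤ 1` gives `11 + 24 = 35`.
      _ ≤ _ := by rw [e 35]; gcongr; nlinarith

/-! ### The lower bound, from a truncated multiple of the norm. -/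

open Classical in
/-- The function equal to `δ ‖x‖` on the unit ball and to `∞` outside. -/
noncomputable def truncatedNorm (n : ℕ) (δ : ℝ) : Rn n → ℝ≥0∞ :=
  fun x => if ‖x‖ ≤ 1 then ENNReal.ofReal (δ * ‖x‖) else ∞

lemma truncatedNorm_le_iff {δ t : ℝ} (ht : 0 ≤ t) (x : Rn n) :
    truncatedNorm n δ x ≤ ENNReal.ofReal t ↔ ‖x‖ ≤ 1 ∧ δ * ‖x‖ ≤ t := by
  unfold truncatedNorm
  split_ifs with h
  · rw [ENNReal.ofReal_le_ofReal_iff ht]; simp [h]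
  · simp [h]

lemma truncatedNorm_mem_cvx0 {δ : ℝ} (hδ : 0 ≤ δ) : truncatedNorm n δ ∈ Cvx0 n := by
  refine ⟨⟨convex_univ, ?_⟩, ?_, by simp [truncatedNorm]⟩
  · intro x _ y _ a b _ _ hab
    rcases eq_or_ne a 0 with rfl | ha
    · simp_all
    rcases eq_or_ne b 0 with rfl | hb
    · simp_all
    have hab' : (a : ℝ) + b = 1 := by exact_mod_cast hab
    by_cases hx : ‖x‖ ≤ 1
    · by_cases hy : ‖y‖ ≤ 1
      · have hn : ‖a • x + b • y‖ ≤ a * ‖x‖ + b * ‖y‖ := by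
          refine (norm_add_le _ _).trans (le_of_eq ?_)
          rw [NNReal.smul_def, NNReal.smul_def, norm_smul, norm_smul]
          simp
        have h1 : ‖a • x + b • y‖ ≤ 1 := by
          refine hn.trans ?_
          nlinarith [a.coe_nonneg, b.coe_nonneg]
        simp only [truncatedNorm, hx, hy, h1, if_true, ENNReal.smul_def, smul_eq_mul]
        rw [← ENNReal.ofReal_coe_nnreal, ← ENNReal.ofReal_coe_nnreal,
          ← ENNReal.ofReal_mul a.coe_nonneg, ← ENNReal.ofReal_mul b.coe_nonneg,
          ← ENNReal.ofReal_add (by positivity) (by positivity)]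
        apply ENNReal.ofReal_le_ofReal
        nlinarith
      · simp [truncatedNorm, hy, ENNReal.smul_def, hb]
    · simp [truncatedNorm, hx, ENNReal.smul_def, ha]
  · rw [lowerSemicontinuous_iff_isClosed_preimage]
    intro a
    have hb : IsClosed {x : Rn n | ‖x‖ ≤ 1} := isClosed_le continuous_norm continuous_const
    rcases eq_or_ne a ∞ with ha | ha
    · simp [ha]
    have : truncatedNorm n δ ⁻¹' Iic a = {x | ‖x‖ ≤ 1} ∩ {x | δ * ‖x‖ ≤ a.toReal} := by
      ext x
      rw [mem_preimage, mem_Iic, ← ENNReal.ofReal_toReal ha,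
        truncatedNorm_le_iff ENNReal.toReal_nonneg]
      simp
    rw [this]
    exact hb.inter (isClosed_le (by fun_prop) continuous_const)

lemma levelVol_truncatedNorm_of_le {δ t : ℝ} (hδ : 0 ≤ δ) (ht : δ ≤ t) :
    levelVol (truncatedNorm n δ) t = volume (Metric.closedBall (0 : Rn n) 1) := by
  unfold levelVol
  congr 1
  ext x
  rw [mem_ofPred_eq, truncatedNorm_le_iff (hδ.trans ht), mem_closedBall_zero_iff]
  refine ⟨fun h => h.1, fun h => ⟨h, ?_⟩⟩
  nlinarith [norm_nonneg x]

lemma levelVol_truncatedNorm_le {δ t : ℝ} (hδ : 0 < δ) (ht : 0 < t) :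
    levelVol (truncatedNorm n δ) t ≤
      ENNReal.ofReal ((t / δ) ^ n) * volume (Metric.closedBall (0 : Rn n) 1) := by
  have := Measure.addHaar_closedBall' (volume : Measure (Rn n)) 0 (r := t / δ) (by positivity)
  rw [finrank_euclideanSpace, Fintype.card_fin] at this
  rw [← this]
  refine measure_mono fun x hx => ?_
  rw [mem_ofPred_eq, truncatedNorm_le_iff ht.le] at hx
  rw [mem_closedBall_zero_iff, le_div_iff₀ hδ]
  linarith [hx.2]

/-- Heights below `δ` contribute at most `∫₀^δ (t/δ)^n dt = δ/(n+1)`; above `δ` the level set is the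
whole ball. -/
lemma expIntegral_truncatedNorm_le {δ : ℝ} (hδ : 0 < δ) :
    expIntegral (truncatedNorm n δ) ≤
      ENNReal.ofReal (δ / (n + 1) + Real.exp (-δ)) * volume (Metric.closedBall (0 : Rn n) 1) := by
  rw [expIntegral_eq_lintegral (measurable_of_mem_cvx0 (truncatedNorm_mem_cvx0 hδ.le)),
    ← Ioc_union_Ioi_eq_Ioi hδ.le, lintegral_union measurableSet_Ioi (Ioc_disjoint_Ioi le_rfl),
    ENNReal.ofReal_add (by positivity) (by positivity), add_mul]
  gcongr
  · have hint : ∫⁻ t in Ioc 0 δ, ENNReal.ofReal ((t / δ) ^ n) = ENNReal.ofReal (δ / (n + 1)) := by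
      rw [← ofReal_integral_eq_lintegral_ofReal, ← intervalIntegral.integral_of_le hδ.le]
      · congr 1
        simp_rw [div_pow]
        rw [intervalIntegral.integral_div, integral_pow]
        simp only [zero_pow n.succ_ne_zero, sub_zero]
        field_simp
        ring
      · exact (Continuous.integrableOn_Icc (by fun_prop)).mono_set Ioc_subset_Icc_self
      · refine (ae_restrict_iff' measurableSet_Ioc).2 (ae_of_all _ fun r hr => ?_)
        have : 0 < r := hr.1
        positivity
    rw [← hint, ← lintegral_mul_const _ (by fun_prop)]
    refine setLIntegral_mono' measurableSet_Ioc fun t ht => ?_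
    calc _ ≤ 1 * levelVol (truncatedNorm n δ) t := by
          gcongr
          rw [ENNReal.ofReal_le_one, Real.exp_le_one_iff]
          linarith [ht.1]
      _ ≤ _ := by rw [one_mul]; exact levelVol_truncatedNorm_le hδ ht.1
  · rw [← lintegral_Ioi_exp_neg, ← lintegral_mul_const _ (by fun_prop)]
    refine setLIntegral_mono' measurableSet_Ioi fun t ht => ?_
    rw [levelVol_truncatedNorm_of_le hδ.le (le_of_lt ht)]

/-- Markov's inequality for the Gamma density. -/
lemma lintegral_Ioi_exp_neg_mul_pow_le (m k : ℕ) {a : ℝ} (ha : 0 < a) :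
    ∫⁻ r in Ioi a, ENNReal.ofReal (Real.exp (-r) * r ^ m) ≤
      ENNReal.ofReal ((m + k).factorial / a ^ k) := by
  rw [div_eq_mul_inv, ENNReal.ofReal_mul (by positivity), ← lintegral_exp_neg_mul_pow,
    ← lintegral_mul_const _ (by fun_prop)]
  refine le_trans ?_ (lintegral_mono_set (Ioi_subset_Ioi ha.le))
  refine setLIntegral_mono' measurableSet_Ioi fun r hr => ?_
  have hr : a < r := hr
  have hr0 : 0 < r := ha.trans hr
  rw [← ENNReal.ofReal_mul (by positivity)]
  apply ENNReal.ofReal_le_ofReal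
  rw [← div_eq_mul_inv, le_div_iff₀ (by positivity), pow_add, mul_assoc]
  gcongr

lemma le_lintegral_Ioc_exp_neg_mul_pow (m k : ℕ) {a : ℝ} (ha : 0 < a) :
    ENNReal.ofReal (m.factorial - (m + k).factorial / a ^ k) ≤
      ∫⁻ r in Ioc 0 a, ENNReal.ofReal (Real.exp (-r) * r ^ m) := by
  have h := lintegral_exp_neg_mul_pow m
  rw [← Ioc_union_Ioi_eq_Ioi ha.le,
    lintegral_union measurableSet_Ioi (Ioc_disjoint_Ioi le_rfl)] at h
  rw [ENNReal.ofReal_sub _ (by positivity), ← h, tsub_le_iff_right]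
  gcongr
  exact lintegral_Ioi_exp_neg_mul_pow_le m k ha

/-- For `r ≤ 1/δ` the level set at height `1/r` is the full ball; the rest is discarded, at the cost
of a Gamma tail. -/
lemma le_expIntegral_transformJ_truncatedNorm {δ : ℝ} (hδ : 0 < δ) (k : ℕ) :
    ENNReal.ofReal (n.factorial - (n + k).factorial / (δ⁻¹) ^ k) *
      volume (Metric.closedBall (0 : Rn n) 1) ≤ expIntegral (transformJ (truncatedNorm n δ)) := by
  rw [expIntegral_transformJ (truncatedNorm_mem_cvx0 hδ.le)]
  refine le_trans (mul_le_mul' (le_lintegral_Ioc_exp_neg_mul_pow n k (inv_pos.2 hδ)) le_rfl) ?_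
  rw [← lintegral_mul_const _ (by fun_prop)]
  refine le_trans ?_ (lintegral_mono_set (s := Ioc 0 δ⁻¹) fun _ h => h.1)
  refine setLIntegral_mono' measurableSet_Ioc fun r hr => ?_
  rw [levelVol_truncatedNorm_of_le hδ.le ((le_inv_comm₀ hr.1 hδ).1 hr.2),
    ENNReal.ofReal_mul (Real.exp_pos _).le, mul_assoc]

lemma le_sJ_truncatedNorm {δ : ℝ} (hδ : 0 < δ) (k : ℕ) :
    ENNReal.ofReal ((n.factorial - (n + k).factorial / (δ⁻¹) ^ k) /
      (δ / (n + 1) + Real.exp (-δ))) ≤ sJ (truncatedNorm n δ) := by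
  have hmem := truncatedNorm_mem_cvx0 (n := n) hδ.le
  have hV := levelVol_truncatedNorm_of_le (n := n) hδ.le le_rfl
  have h0 : volume (Metric.closedBall (0 : Rn n) 1) ≠ 0 :=
    (Metric.measure_closedBall_pos _ _ one_pos).ne'
  have h1 : volume (Metric.closedBall (0 : Rn n) 1) ≠ ∞ :=
    (isCompact_closedBall _ _).measure_ne_top
  rw [sJ_eq_div hmem hδ (hV ▸ h0) (hV ▸ h1), ENNReal.ofReal_div_of_pos (by positivity),
    ← ENNReal.mul_div_mul_right _ _ h0 h1]
  exact ENNReal.div_le_div (le_expIntegral_transformJ_truncatedNorm hδ k)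
    (expIntegral_truncatedNorm_le hδ)

lemma factorial_add_self_le (n : ℕ) : (n + n).factorial ≤ n.factorial * (2 * n) ^ n := by
  rw [← Nat.factorial_mul_descFactorial (Nat.le_add_left n n), Nat.add_sub_cancel, two_mul]
  gcongr
  exact Nat.descFactorial_le_pow _ _

lemma exists_le_sJ (hn : 8 ≤ n) : ∃ φ ∈ Cvx0 n,
    ENNReal.ofReal ((1 + (1 / 16) / (n : ℝ)) * n.factorial) ≤ sJ φ := by
  have hn8 : (8 : ℝ) ≤ n := by exact_mod_cast hn
  have hn0 : (0 : ℝ) < n := by linarith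
  set δ : ℝ := 1 / (4 * n) with hδ
  have hδ0 : 0 < δ := by positivity
  have hδn : δ * n = 1 / 4 := by rw [hδ]; field_simp
  refine ⟨truncatedNorm n δ, truncatedNorm_mem_cvx0 hδ0.le,
    le_trans (ENNReal.ofReal_le_ofReal ?_) (le_sJ_truncatedNorm hδ0 n)⟩
  have hf : (0 : ℝ) < n.factorial := by positivity
  -- Markov with `k = n`: `(2n)! ≤ n! (2n)^n` against `(4n)^n` leaves `n! 2^{-n}`.
  have h1 : ((n + n).factorial : ℝ) / (δ⁻¹) ^ n ≤ n.factorial * (1 / 2) ^ n := by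
    rw [div_le_iff₀ (by positivity), mul_assoc, ← mul_pow]
    have : (1 / 2 : ℝ) * δ⁻¹ = 2 * n := by rw [hδ]; field_simp; norm_num
    rw [this]
    exact_mod_cast factorial_add_self_le n
  -- This is `32 n ≤ 2 ^ n`, an equality at `n = 8`.
  have h2 : (1 / 2 : ℝ) ^ n ≤ δ / 8 := by
    have : 32 * n ≤ 2 ^ n := by
      clear * - hn
      induction n, hn using Nat.le_induction with
      | base => norm_num
      | succ m hm ih => rw [pow_succ]; omega
    have : 32 * (n : ℝ) ≤ 2 ^ n := by exact_mod_cast this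
    rw [one_div, inv_pow, hδ, div_div]
    rw [inv_eq_one_div]
    apply one_div_le_one_div_of_le (by positivity)
    linarith
  have h3 : Real.exp (-δ) ≤ 1 - δ + δ ^ 2 := by
    have h := Real.add_one_le_exp δ
    rw [Real.exp_neg]
    calc (Real.exp δ)⁻¹ ≤ (δ + 1)⁻¹ := by gcongr
      _ ≤ _ := by
        rw [inv_le_iff_one_le_mul₀ (by positivity)]
        nlinarith [pow_pos hδ0 3]
  have h4 : δ / (n + 1) ≤ δ / 9 := by gcongr; linarith
  have h5 : δ ≤ 1 / 32 := by nlinarith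
  have h6 : (1 / 16 : ℝ) / n = δ / 4 := by rw [hδ]; field_simp; norm_num
  rw [le_div_iff₀ (by positivity), h6]
  have h7 : δ / (n + 1) + Real.exp (-δ) ≤ 1 - 3 / 4 * δ := by nlinarith
  calc (1 + δ / 4) * n.factorial * (δ / (n + 1) + Real.exp (-δ))
      ≤ (1 + δ / 4) * n.factorial * (1 - 3 / 4 * δ) := by gcongr
    _ = n.factorial * ((1 + δ / 4) * (1 - 3 / 4 * δ)) := by ring
    _ ≤ n.factorial * (1 - δ / 8) := by gcongr; nlinarith
    _ ≤ _ := by nlinarith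

/-! ### Linear invariance and normalization. -/

lemma comp_linearMap_mem_cvx0 {φ : Rn n → ℝ≥0∞} (hφ : φ ∈ Cvx0 n) (T : Rn n →ₗ[ℝ] Rn n) :
    φ ∘ T ∈ Cvx0 n := by
  refine ⟨⟨convex_univ, fun x _ y _ a b ha hb hab => ?_⟩,
    hφ.2.1.comp T.continuous_of_finiteDimensional, by simp [hφ.2.2]⟩
  have := hφ.1.2 (mem_univ (T x)) (mem_univ (T y)) ha hb hab
  simpa [NNReal.smul_def] using this

lemma levelVol_comp_linearMap (φ : Rn n → ℝ≥0∞) {T : Rn n →ₗ[ℝ] Rn n}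
    (hT : LinearMap.det T ≠ 0) (t : ℝ) :
    levelVol (φ ∘ T) t = ENNReal.ofReal |(LinearMap.det T)⁻¹| * levelVol φ t :=
  Measure.addHaar_preimage_linearMap volume hT {x | φ x ≤ ENNReal.ofReal t}

/-- Both integrals acquire the same factor `|det T|⁻¹`. -/
lemma sJ_comp_linearMap {φ : Rn n → ℝ≥0∞} (hφ : φ ∈ Cvx0 n) {T : Rn n →ₗ[ℝ] Rn n}
    (hT : LinearMap.det T ≠ 0) (h0 : levelVol φ 1 ≠ 0) (h1 : levelVol φ 1 ≠ ∞) :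
    sJ (φ ∘ T) = sJ φ := by
  have hφT := comp_linearMap_mem_cvx0 hφ T
  have hd : ENNReal.ofReal |(LinearMap.det T)⁻¹| ≠ 0 := by simpa using hT
  rw [sJ_eq_div hφ one_pos h0 h1, sJ_eq_div hφT one_pos, expIntegral_transformJ hφ,
    expIntegral_transformJ hφT, expIntegral_eq_lintegral (measurable_of_mem_cvx0 hφ),
    expIntegral_eq_lintegral (measurable_of_mem_cvx0 hφT)]
  · simp_rw [levelVol_comp_linearMap φ hT,
      mul_left_comm _ (ENNReal.ofReal |(LinearMap.det T)⁻¹|) _]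
    rw [lintegral_const_mul' _ _ ENNReal.ofReal_ne_top,
      lintegral_const_mul' _ _ ENNReal.ofReal_ne_top,
      ENNReal.mul_div_mul_left _ _ hd ENNReal.ofReal_ne_top]
  · rw [levelVol_comp_linearMap φ hT]
    exact mul_ne_zero hd h0
  · rw [levelVol_comp_linearMap φ hT]
    exact ENNReal.mul_ne_top ENNReal.ofReal_ne_top h1

/-- The interior of the standard simplex with a vertex at the origin. -/
def openSimplex (n : ℕ) : Set (Rn n) := {c | (∀ i, 0 < c i) ∧ ∑ i, c i < 1}

lemma isOpen_openSimplex : IsOpen (openSimplex n) := by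
  have : openSimplex n = (⋂ i, {c : Rn n | 0 < c i}) ∩ {c | ∑ i, c i < 1} := by
    ext; simp [openSimplex]
  rw [this]
  refine IsOpen.inter (isOpen_iInter_of_finite fun i => ?_) ?_
  · exact isOpen_lt continuous_const (by fun_prop)
  · exact isOpen_lt (by fun_prop) continuous_const

lemma openSimplex_nonempty : (openSimplex n).Nonempty := by
  refine ⟨WithLp.toLp 2 fun _ => 1 / ((n : ℝ) + 1), fun i => ?_, ?_⟩
  · simp only; positivity
  · simp only [Finset.sum_const, Finset.card_univ, Fintype.card_fin, nsmul_eq_mul]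
    rw [mul_one_div, div_lt_one (by positivity)]
    linarith

/-- The standard basis of `ℝⁿ`. -/
noncomputable abbrev stdBasis (n : ℕ) : Module.Basis (Fin n) ℝ (Rn n) :=
  (EuclideanSpace.basisFun (Fin n) ℝ).toBasis

lemma det_constr (v : Fin n → Rn n) :
    LinearMap.det ((stdBasis n).constr ℝ v) = (stdBasis n).det v := by
  have h := (stdBasis n).det_comp ((stdBasis n).constr ℝ v) (stdBasis n)
  rw [Module.Basis.det_self, mul_one] at h
  rw [← h]
  congr 1
  ext1 i
  rw [Function.comp_apply, Module.Basis.constr_basis]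

lemma constr_apply_eq_sum (v : Fin n → Rn n) (c : Rn n) :
    (stdBasis n).constr ℝ v c = ∑ i, c i • v i := by
  rw [Module.Basis.constr_apply_fintype]
  rfl

/-- Cramer's rule: coordinates in the system `v` are ratios of determinants. -/
lemma det_update_constr (v : Fin n → Rn n) (c : Rn n) (i : Fin n) :
    (stdBasis n).det (Function.update v i ((stdBasis n).constr ℝ v c)) =
      (stdBasis n).det v * c i := by
  have h := (stdBasis n).det_comp ((stdBasis n).constr ℝ v) (Function.update (stdBasis n) i c)
  have h1 : (stdBasis n).constr ℝ v ∘ Function.update (stdBasis n) i c =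
      Function.update v i ((stdBasis n).constr ℝ v c) := by
    ext1 j
    rcases eq_or_ne j i with rfl | hj
    · simp
    · rw [Function.comp_apply, Function.update_of_ne hj, Function.update_of_ne hj,
        Module.Basis.constr_basis]
  have h2 : (stdBasis n).det (Function.update (stdBasis n) i c) = c i := by
    rw [Module.Basis.det_apply, Module.Basis.toMatrix_update, Module.Basis.toMatrix_self,
      ← Matrix.cramer_apply, Matrix.cramer_one]
    rfl
  rw [h1, h2, det_constr] at h
  exact h

lemma constr_mem_of_mem_openSimplex {K : Set (Rn n)} (hK : Convex ℝ K) (h0 : (0 : Rn n) ∈ K)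
    {v : Fin n → Rn n} (hv : ∀ i, v i ∈ K) {c : Rn n} (hc : c ∈ openSimplex n) :
    (stdBasis n).constr ℝ v c ∈ K := by
  have h := hK.sum_mem (t := Finset.univ) (w := fun o : Option (Fin n) => o.elim (1 - ∑ i, c i) c)
    (z := fun o => o.elim 0 v) ?_ ?_ ?_
  · rw [constr_apply_eq_sum]
    simpa [Fintype.sum_option] using h
  · rintro (_ | i) _
    · simpa using hc.2.le
    · exact (hc.1 i).le
  · simp [Fintype.sum_option]
  · rintro (_ | i) _
    · exact h0
    · exact hv i

/-- A convex set of positive finite volume containing the origin can be brought by a linear map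
into a position where it lies between a simplex and a ball that depend on `n` only. -/
lemma exists_linearMap_position {K : Set (Rn n)} (hK : Convex ℝ K) (h0 : (0 : Rn n) ∈ K)
    (hpos : volume K ≠ 0) (hfin : volume K ≠ ∞) :
    ∃ T : Rn n →ₗ[ℝ] Rn n, LinearMap.det T ≠ 0 ∧ openSimplex n ⊆ T ⁻¹' K ∧
      T ⁻¹' K ⊆ {c | ∀ i, |c i| ≤ 2} := by
  have hO0 : volume (openSimplex n) ≠ 0 := (isOpen_openSimplex.measure_pos _ openSimplex_nonempty).ne'
  -- The simplex with vertices `0` and the `v i` has its interior inside `K`, so its volume is at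
  -- most that of `K`.
  have hbound : ∀ v : Fin n → Rn n, (∀ i, v i ∈ K) → (stdBasis n).det v ≠ 0 →
      ENNReal.ofReal |(stdBasis n).det v| ≤ volume K / volume (openSimplex n) := by
    intro v hv hdet
    have hsub : openSimplex n ⊆ (stdBasis n).constr ℝ v ⁻¹' K :=
      fun c hc => constr_mem_of_mem_openSimplex hK h0 hv hc
    have h := measure_mono (μ := volume) hsub
    rw [Measure.addHaar_preimage_linearMap _ (by rwa [det_constr]), det_constr, abs_inv,
      ENNReal.ofReal_inv_of_pos (by positivity)] at h
    rw [ENNReal.le_div_iff_mul_le (Or.inl hO0) (Or.inr hfin)]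
    calc _ ≤ ENNReal.ofReal |(stdBasis n).det v| *
          ((ENNReal.ofReal |(stdBasis n).det v|)⁻¹ * volume K) := by gcongr
      _ = volume K := by
        rw [← mul_assoc, ENNReal.mul_inv_cancel (by simpa using hdet) ENNReal.ofReal_ne_top,
          one_mul]
  have hq : volume K / volume (openSimplex n) ≠ ∞ := ENNReal.div_ne_top hfin hO0
  set S : Set ℝ := {d | ∃ v : Fin n → Rn n, (∀ i, v i ∈ K) ∧ d = |(stdBasis n).det v|}
  have hbdd : BddAbove S := by
    refine ⟨(volume K / volume (openSimplex n)).toReal, ?_⟩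
    rintro _ ⟨v, hv, rfl⟩
    by_cases hdet : (stdBasis n).det v = 0
    · rw [hdet, abs_zero]; exact ENNReal.toReal_nonneg
    · exact (ENNReal.ofReal_le_iff_le_toReal hq).1 (hbound v hv hdet)
  obtain ⟨v₀, hv₀, hdet₀⟩ : ∃ v : Fin n → Rn n, (∀ i, v i ∈ K) ∧ (stdBasis n).det v ≠ 0 := by
    have hspan : Submodule.span ℝ K = ⊤ := by
      by_contra hne
      exact hpos (measure_mono_null Submodule.subset_span
        (Measure.addHaar_submodule volume _ hne))
    let B := Module.Basis.ofSpan hspan.ge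
    let B' := B.reindex (B.indexEquiv (stdBasis n))
    refine ⟨B', fun i => ?_, ((stdBasis n).isUnit_det B').ne_zero⟩
    rw [Module.Basis.reindex_apply]
    exact Module.Basis.ofSpan_subset hspan.ge (mem_range_self _)
  have hS0 : 0 < sSup S :=
    lt_of_lt_of_le (abs_pos.2 hdet₀) (le_csSup hbdd ⟨v₀, hv₀, rfl⟩)
  -- `K` need not be closed, so the supremum may not be attained. A `v` beyond half of it suffices:
  -- by Cramer, `|c i| |det v| ≤ sSup S < 2 |det v|`.
  obtain ⟨_, ⟨v, hv, rfl⟩, hlt⟩ := exists_lt_of_lt_csSup (s := S) ⟨_, v₀, hv₀, rfl⟩ (half_lt_self hS0)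
  have hdet : 0 < |(stdBasis n).det v| := by linarith
  refine ⟨(stdBasis n).constr ℝ v, ?_, fun c hc => constr_mem_of_mem_openSimplex hK h0 hv hc, ?_⟩
  · rw [det_constr]; exact abs_pos.1 hdet
  · intro c hc i
    have hle : |(stdBasis n).det (Function.update v i ((stdBasis n).constr ℝ v c))| ≤ sSup S := by
      refine le_csSup hbdd ⟨_, fun j => ?_, rfl⟩
      rcases eq_or_ne j i with rfl | hj
      · rw [Function.update_self]; exact hc
      · rw [Function.update_of_ne hj]; exact hv j
    rw [det_update_constr, abs_mul] at hle
    by_contra hcon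
    push Not at hcon
    nlinarith

lemma convex_sublevel {φ : Rn n → ℝ≥0∞} (hφ : φ ∈ Cvx0 n) (t : ℝ) :
    Convex ℝ {x | φ x ≤ ENNReal.ofReal t} := by
  intro x hx y hy a b ha hb hab
  lift a to ℝ≥0 using ha
  lift b to ℝ≥0 using hb
  have hab : a + b = 1 := by exact_mod_cast hab
  have := hφ.1.2 (mem_univ x) (mem_univ y) (zero_le (a := a)) (zero_le (a := b)) hab
  refine this.trans ?_
  calc a • φ x + b • φ y ≤ a • ENNReal.ofReal t + b • ENNReal.ofReal t := by
        gcongr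
        · exact hx
        · exact hy
    _ = ENNReal.ofReal t := by rw [← add_smul, hab, one_smul]

/-- The cube `|x i| ≤ 2` gives `‖x‖ ≤ 2√n`; the radius `2n + 1` is cruder but positive for every
`n`. -/
lemma exists_normalized {φ : Rn n → ℝ≥0∞} (hφ : φ ∈ Cvx0 n) (h0 : levelVol φ 1 ≠ 0)
    (h1 : levelVol φ 1 ≠ ∞) : ∃ ψ ∈ Cvx0 n, sJ ψ = sJ φ ∧
      (∀ x ∈ openSimplex n, ψ x ≤ 1) ∧ ∀ x, ψ x ≤ 1 → ‖x‖ ≤ 2 * n + 1 := by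
  obtain ⟨T, hT, hT1, hT2⟩ := exists_linearMap_position (convex_sublevel hφ 1)
    (by simp [hφ.2.2]) h0 h1
  refine ⟨φ ∘ T, comp_linearMap_mem_cvx0 hφ T, sJ_comp_linearMap hφ hT h0 h1,
    fun x hx => by simpa using hT1 hx, fun x hx => ?_⟩
  have hx2 : ∀ i, |x i| ≤ 2 := hT2 (by simpa using hx)
  rw [EuclideanSpace.norm_eq]
  apply Real.sqrt_le_iff.2 ⟨by positivity, ?_⟩
  calc ∑ i, ‖x i‖ ^ 2 ≤ ∑ _i : Fin n, (2 : ℝ) ^ 2 :=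
        Finset.sum_le_sum fun i _ => pow_le_pow_left₀ (norm_nonneg _) (hx2 i) 2
    _ = 4 * n := by simp; ring
    _ ≤ _ := by nlinarith [(Nat.cast_nonneg n : (0 : ℝ) ≤ n)]

/-! ### Selection of convergent subsequences of convex sets. -/

lemma convex_liminf {F : Type*} [AddCommGroup F] [Module ℝ F] {E : ℕ → Set F}
    (hE : ∀ k, Convex ℝ (E k)) : Convex ℝ {x | ∀ᶠ k in atTop, x ∈ E k} := by
  intro x hx y hy a b ha hb hab
  filter_upwards [hx, hy] with k h1 h2 using hE k h1 h2 ha hb hab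

/-- A selection theorem for convex sets with a common interior point. -/
lemma exists_strictMono_liminf {F : Type*} [NormedAddCommGroup F] [NormedSpace ℝ F]
    [TopologicalSpace.SeparableSpace F] {E : ℕ → Set F} (hE : ∀ k, Convex ℝ (E k)) {U : Set F}
    (hU : IsOpen U) (hne : U.Nonempty) (hUE : ∀ k, U ⊆ E k) :
    ∃ g : ℕ → ℕ, StrictMono g ∧ ∀ x ∉ closure {x | ∀ᶠ k in atTop, x ∈ E (g k)},
      ∀ᶠ k in atTop, x ∉ E (g k) := by
  classical
  -- Compactness of `ℕ → Bool`: along a subsequence each point of a dense sequence is eventually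
  -- inside or eventually outside.
  let f : ℕ → ℕ → Bool := fun k i => decide (TopologicalSpace.denseSeq F i ∈ E k)
  obtain ⟨a, g, hg, ha⟩ := SeqCompactSpace.tendsto_subseq f
  refine ⟨g, hg, fun x hx => ?_⟩
  by_contra hfr
  have hfr : ∃ᶠ k in atTop, x ∈ E (g k) := by
    simpa only [Filter.Frequently, not_not] using hfr
  set L := {x | ∀ᶠ k in atTop, x ∈ E (g k)}
  obtain ⟨u, hu⟩ := hne
  have hpath : Tendsto (fun s : ℝ => x + s • (u - x)) (𝓝[>] 0) (𝓝 x) := by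
    have : Continuous fun s : ℝ => x + s • (u - x) := by fun_prop
    have := this.tendsto 0
    simp only [zero_smul, add_zero] at this
    exact this.mono_left nhdsWithin_le_nhds
  have hev1 : ∀ᶠ s : ℝ in 𝓝[>] 0, x + s • (u - x) ∈ (closure L)ᶜ :=
    hpath (isClosed_closure.isOpen_compl.mem_nhds hx)
  have hev2 : ∀ᶠ s : ℝ in 𝓝[>] 0, s ∈ Ioo (0 : ℝ) 1 := Ioo_mem_nhdsGT one_pos
  obtain ⟨s, hsL, hs0, hs1⟩ := (hev1.and hev2).exists
  -- Each `y ∈ W` lies on a segment from `x` to a point of `U`. If `x` is in `E (g k)` infinitely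
  -- often, so is `y`; a dense `y` is then eventually inside, contradicting `y ∉ closure L`.
  let W : Set F := {y | x + s⁻¹ • (y - x) ∈ U} ∩ (closure L)ᶜ
  have hW : IsOpen W :=
    (hU.preimage (by fun_prop : Continuous fun y => x + s⁻¹ • (y - x))).inter
      isClosed_closure.isOpen_compl
  have hWne : W.Nonempty := by
    refine ⟨x + s • (u - x), ?_, hsL⟩
    change x + s⁻¹ • (x + s • (u - x) - x) ∈ U
    rw [add_sub_cancel_left, smul_smul, inv_mul_cancel₀ hs0.ne', one_smul, add_sub_cancel]
    exact hu
  obtain ⟨i, hyU, hyL⟩ := (TopologicalSpace.denseRange_denseSeq F).exists_mem_open hW hWne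
  set y := TopologicalSpace.denseSeq F i
  have hfr' : ∃ᶠ k in atTop, y ∈ E (g k) := by
    refine hfr.mono fun k hk => ?_
    have hmem := hE (g k) hk (hUE (g k) hyU) (sub_nonneg.2 hs1.le) hs0.le (sub_add_cancel 1 s)
    have : (1 - s) • x + s • (x + s⁻¹ • (y - x)) = y := by
      rw [smul_add, smul_smul, mul_inv_cancel₀ hs0.ne', one_smul, sub_smul, one_smul]
      abel
    rwa [this] at hmem
  have hconst : ∀ᶠ k in atTop, f (g k) i = a i := by
    have := (tendsto_pi_nhds.1 ha) i
    rw [nhds_discrete, tendsto_pure] at this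
    exact this
  refine hyL (subset_closure ?_)
  obtain ⟨k, hk, hk'⟩ := (hfr'.and_eventually hconst).exists
  have hai : a i = true := by rw [← hk']; simpa [f] using hk
  filter_upwards [hconst] with k hk
  rw [hai] at hk
  simpa [f] using hk

/-! ### Recovering functions from epigraphs. -/

/-- The function with a given epigraph. -/
noncomputable def ofEpi (C : Set (Rn n × ℝ)) : Rn n → ℝ≥0∞ :=
  fun x => ⨅ (t : ℝ) (_ : (x, t) ∈ C), ENNReal.ofReal t

section ofEpi

variable {C : Set (Rn n × ℝ)}

/-- Closedness makes the infimum attained: approach height `t` from above. -/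
lemma ofEpi_le_iff (hcl : IsClosed C) (hup : ∀ x s t, (x, s) ∈ C → s ≤ t → (x, t) ∈ C)
    (x : Rn n) {t : ℝ} (ht : 0 ≤ t) : ofEpi C x ≤ ENNReal.ofReal t ↔ (x, t) ∈ C := by
  constructor
  · intro h
    have hmem : ∀ k : ℕ, (x, t + 1 / ((k : ℝ) + 1)) ∈ C := by
      intro k
      have hk : 0 < 1 / ((k : ℝ) + 1) := by positivity
      have hlt : ofEpi C x < ENNReal.ofReal (t + 1 / ((k : ℝ) + 1)) :=
        h.trans_lt ((ENNReal.ofReal_lt_ofReal_iff (by positivity)).2 (by linarith))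
      simp only [ofEpi, iInf_lt_iff] at hlt
      obtain ⟨s, hs, hst⟩ := hlt
      exact hup x s _ hs ((ENNReal.ofReal_lt_ofReal_iff (by positivity)).1 hst).le
    have hlim : Tendsto (fun k : ℕ => (x, t + 1 / ((k : ℝ) + 1))) atTop (𝓝 (x, t + 0)) :=
      tendsto_const_nhds.prodMk_nhds
        (tendsto_const_nhds.add tendsto_one_div_add_atTop_nhds_zero_nat)
    rw [add_zero] at hlim
    exact hcl.mem_of_tendsto hlim (Eventually.of_forall hmem)
  · intro h
    exact iInf₂_le t h

lemma ofEpi_mem_cvx0 (hcl : IsClosed C) (hup : ∀ x s t, (x, s) ∈ C → s ≤ t → (x, t) ∈ C)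
    (hconv : Convex ℝ C) (h0 : ((0 : Rn n), (0 : ℝ)) ∈ C) : ofEpi C ∈ Cvx0 n := by
  refine ⟨⟨convex_univ, ?_⟩, ?_, ?_⟩
  · intro x _ y _ a b _ _ hab
    rcases eq_or_ne a 0 with rfl | ha
    · simp_all
    rcases eq_or_ne b 0 with rfl | hb
    · simp_all
    by_cases hx : ofEpi C x = ∞
    · simp [hx, ENNReal.smul_def, ha]
    by_cases hy : ofEpi C y = ∞
    · simp [hy, ENNReal.smul_def, hb]
    have hx' := (ofEpi_le_iff hcl hup x ENNReal.toReal_nonneg).1 (ENNReal.ofReal_toReal hx).ge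
    have hy' := (ofEpi_le_iff hcl hup y ENNReal.toReal_nonneg).1 (ENNReal.ofReal_toReal hy).ge
    have hmem := hconv hx' hy' a.coe_nonneg b.coe_nonneg (by exact_mod_cast hab)
    have h1 : a • ofEpi C x + b • ofEpi C y =
        ENNReal.ofReal (a * (ofEpi C x).toReal + b * (ofEpi C y).toReal) := by
      rw [ENNReal.ofReal_add (by positivity) (by positivity), ENNReal.ofReal_mul a.coe_nonneg,
        ENNReal.ofReal_mul b.coe_nonneg, ENNReal.ofReal_toReal hx, ENNReal.ofReal_toReal hy,
        ENNReal.ofReal_coe_nnreal, ENNReal.ofReal_coe_nnreal]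
      rfl
    rw [h1, ofEpi_le_iff hcl hup _ (by positivity)]
    exact hmem
  · rw [lowerSemicontinuous_iff_isClosed_preimage]
    intro a
    rcases eq_or_ne a ∞ with ha | ha
    · simp [ha]
    have : ofEpi C ⁻¹' Iic a = (fun x => (x, a.toReal)) ⁻¹' C := by
      ext x
      rw [mem_preimage, mem_Iic, ← ENNReal.ofReal_toReal ha,
        ofEpi_le_iff hcl hup _ ENNReal.toReal_nonneg, ENNReal.ofReal_toReal ha]
      rfl
    rw [this]
    exact hcl.preimage (by fun_prop)
  · have := (ofEpi_le_iff hcl hup 0 le_rfl).2 h0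
    simpa using this

lemma epi_ofEpi (hcl : IsClosed C) (hup : ∀ x s t, (x, s) ∈ C → s ≤ t → (x, t) ∈ C)
    (hnn : ∀ p ∈ C, 0 ≤ p.2) : epi (ofEpi C) = C := by
  ext ⟨x, t⟩
  constructor
  · rintro ⟨h, ht⟩
    exact (ofEpi_le_iff hcl hup x ht).1 h
  · intro h
    exact ⟨(ofEpi_le_iff hcl hup x (hnn _ h)).2 h, hnn _ h⟩

end ofEpi

/-! ### The integrals as epigraph measures, and compactness. -/

/-- The product of Lebesgue measure on `ℝⁿ` and the measure on `(0, ∞)` with density `w`. -/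
noncomputable def epiMeasure (n : ℕ) (w : ℝ → ℝ≥0∞) : Measure (Rn n × ℝ) :=
  (volume : Measure (Rn n)).prod ((volume.restrict (Ioi 0)).withDensity w)

lemma epiMeasure_epi {φ : Rn n → ℝ≥0∞} (hφ : φ ∈ Cvx0 n) {w : ℝ → ℝ≥0∞} (hw : Measurable w) :
    epiMeasure n w (epi φ) = ∫⁻ t in Ioi (0 : ℝ), w t * levelVol φ t := by
  rw [epiMeasure, Measure.prod_apply_symm (isClosed_epi hφ.2.1).measurableSet,
    lintegral_withDensity_eq_lintegral_mul₀ hw.aemeasurable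
      (measurable_measure_prodMk_right (isClosed_epi hφ.2.1).measurableSet).aemeasurable]
  refine setLIntegral_congr_fun measurableSet_Ioi fun t ht => ?_
  have ht : 0 ≤ t := le_of_lt ht
  simp [epi, levelVol, ht]

lemma epiMeasure_absolutelyContinuous (n : ℕ) (w : ℝ → ℝ≥0∞) :
    epiMeasure n w ≪ (volume : Measure (Rn n × ℝ)) :=
  Measure.AbsolutelyContinuous.rfl.prod
    ((withDensity_absolutelyContinuous _ _).trans Measure.restrict_le_self.absolutelyContinuous)

/-- The density of the weight that represents `∫ e^{-φ}`. -/
noncomputable def expWeight (t : ℝ) : ℝ≥0∞ := ENNReal.ofReal (Real.exp (-t))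

/-- The density of the weight that represents `∫ e^{-𝓙 φ}`. -/
noncomputable def expInvWeight (n : ℕ) (t : ℝ) : ℝ≥0∞ :=
  ENNReal.ofReal ((t ^ 2)⁻¹) * (ENNReal.ofReal (Real.exp (-t⁻¹)) * ENNReal.ofReal (t⁻¹ ^ n))

lemma measurable_expWeight : Measurable expWeight := by unfold expWeight; fun_prop

lemma measurable_expInvWeight (n : ℕ) : Measurable (expInvWeight n) := by
  unfold expInvWeight; fun_prop

lemma epiMeasure_expWeight {φ : Rn n → ℝ≥0∞} (hφ : φ ∈ Cvx0 n) :
    epiMeasure n expWeight (epi φ) = expIntegral φ := by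
  rw [epiMeasure_epi hφ measurable_expWeight,
    expIntegral_eq_lintegral (measurable_of_mem_cvx0 hφ)]
  rfl

/-- The substitution `r = 1/t` turns `V(1/r)` into `V(t)`. -/
lemma epiMeasure_expInvWeight {φ : Rn n → ℝ≥0∞} (hφ : φ ∈ Cvx0 n) :
    epiMeasure n (expInvWeight n) (epi φ) = expIntegral (transformJ φ) := by
  rw [epiMeasure_epi hφ (measurable_expInvWeight n), expIntegral_transformJ hφ,
    lintegral_Ioi_inv fun r =>
      ENNReal.ofReal (Real.exp (-r)) * (ENNReal.ofReal (r ^ n) * levelVol φ r⁻¹)]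
  refine lintegral_congr fun t => ?_
  rw [inv_inv, expInvWeight]
  ring

/-- A function in `Cvx₀` below all those whose sublevel set at height `1` lies in the ball of
radius `R`. -/
noncomputable def coneBound (n : ℕ) (R : ℝ) : Rn n → ℝ≥0∞ :=
  fun x => ENNReal.ofReal (‖x‖ / R - 1)

lemma coneBound_mem_cvx0 {R : ℝ} (hR : 0 < R) : coneBound n R ∈ Cvx0 n := by
  refine ⟨⟨convex_univ, fun x _ y _ a b _ _ hab => ?_⟩, Continuous.lowerSemicontinuous ?_,
    by simp [coneBound]⟩
  · have hab' : (a : ℝ) + b = 1 := by exact_mod_cast hab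
    have hn : ‖a • x + b • y‖ ≤ a * ‖x‖ + b * ‖y‖ := by
      refine (norm_add_le _ _).trans (le_of_eq ?_)
      rw [NNReal.smul_def, NNReal.smul_def, norm_smul, norm_smul]
      simp
    have h1 : ‖a • x + b • y‖ / R - 1 ≤ a * (‖x‖ / R - 1) + b * (‖y‖ / R - 1) := by
      have : ‖a • x + b • y‖ / R ≤ (a * ‖x‖ + b * ‖y‖) / R := by gcongr
      calc _ ≤ (a * ‖x‖ + b * ‖y‖) / R - (a + b) := by rw [hab']; linarith
        _ = _ := by ring
    refine (ENNReal.ofReal_le_ofReal h1).trans (ENNReal.ofReal_add_le.trans (le_of_eq ?_))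
    rw [ENNReal.ofReal_mul a.coe_nonneg, ENNReal.ofReal_mul b.coe_nonneg,
      ENNReal.ofReal_coe_nnreal, ENNReal.ofReal_coe_nnreal]
    rfl
  · exact ENNReal.continuous_ofReal.comp (by fun_prop)

lemma levelVol_coneBound_ne_top {R : ℝ} (hR : 0 < R) : levelVol (coneBound n R) 1 ≠ ∞ := by
  refine ne_top_of_le_ne_top
    ((isCompact_closedBall (0 : Rn n) (2 * R)).measure_ne_top (μ := volume)) (measure_mono ?_)
  intro x hx
  have hx : ENNReal.ofReal (‖x‖ / R - 1) ≤ ENNReal.ofReal 1 := hx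
  rw [ENNReal.ofReal_le_ofReal_iff zero_le_one] at hx
  rw [mem_closedBall_zero_iff, ← div_le_iff₀ hR]
  linarith

/-- Shrinking `x` by `1/(1 + φ x)` brings it into `{φ ≤ 1}`, so `‖x‖ ≤ R (1 + φ x)`. -/
lemma coneBound_le {φ : Rn n → ℝ≥0∞} (hφ : φ ∈ Cvx0 n) {R : ℝ} (hR : 0 < R)
    (h : ∀ x, φ x ≤ 1 → ‖x‖ ≤ R) (x : Rn n) : coneBound n R x ≤ φ x := by
  rcases eq_or_ne (φ x) ∞ with hx | hx
  · simp [hx]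
  rw [coneBound, ← ENNReal.ofReal_toReal hx]
  apply ENNReal.ofReal_le_ofReal
  set t := (φ x).toReal with ht
  have ht0 : 0 ≤ t := ENNReal.toReal_nonneg
  have hφt : φ x = ENNReal.ofReal t := (ENNReal.ofReal_toReal hx).symm
  have hs := apply_smul_le hφ (c := (1 + t)⁻¹) (by positivity) (inv_le_one_of_one_le₀ (by linarith)) x
  have := h _ (hs.trans ?_)
  · rw [norm_smul, Real.norm_of_nonneg (by positivity), inv_mul_le_iff₀ (by positivity),
      ← div_le_iff₀ hR] at this
    linarith
  · rw [hφt, ← ENNReal.ofReal_mul (by positivity), ENNReal.ofReal_le_one,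
      inv_mul_le_iff₀ (by positivity)]
    linarith

lemma epi_anti {φ ψ : Rn n → ℝ≥0∞} (h : ∀ x, φ x ≤ ψ x) : epi ψ ⊆ epi φ :=
  fun p hp => ⟨(h p.1).trans hp.1, hp.2⟩

/-- Compactness of normalized sequences in `Cvx₀`, and continuity of `s^𝓙` along them. -/
lemma exists_limit {φ : ℕ → Rn n → ℝ≥0∞} (hφ : ∀ k, φ k ∈ Cvx0 n) {O : Set (Rn n)} (hO : IsOpen O)
    (hOne : O.Nonempty) (hOφ : ∀ k, ∀ x ∈ O, φ k x ≤ 1) {R : ℝ} (hR : 0 < R)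
    (hRφ : ∀ k x, φ k x ≤ 1 → ‖x‖ ≤ R) :
    ∃ ψ ∈ Cvx0 n, ∃ g : ℕ → ℕ, StrictMono g ∧ Tendsto (fun k => sJ (φ (g k))) atTop (𝓝 (sJ ψ)) := by
  have hUE : ∀ k, O ×ˢ Ioi (1 : ℝ) ⊆ epi (φ k) := by
    rintro k ⟨x, t⟩ ⟨hx, ht⟩
    have ht : 1 < t := ht
    exact ⟨(hOφ k x hx).trans (ENNReal.one_le_ofReal.2 ht.le), by linarith⟩
  obtain ⟨g, hg, hlim⟩ := exists_strictMono_liminf (fun k => convex_epi (hφ k).1)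
    (hO.prod isOpen_Ioi) (hOne.prod nonempty_Ioi) hUE
  set L : Set (Rn n × ℝ) := {p | ∀ᶠ k in atTop, p ∈ epi (φ (g k))}
  have hLconv : Convex ℝ L := convex_liminf fun k => convex_epi (hφ (g k)).1
  have hLup : ∀ (d : ℝ), 0 ≤ d → ∀ p ∈ L, p + ((0 : Rn n), d) ∈ L := by
    intro d hd p hp
    filter_upwards [hp] with k hk
    refine ⟨?_, by simpa using add_nonneg hk.2 hd⟩
    simp only [Prod.fst_add, add_zero, Prod.snd_add]
    exact hk.1.trans (ENNReal.ofReal_le_ofReal (by linarith))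
  have hup : ∀ x s t, (x, s) ∈ closure L → s ≤ t → (x, t) ∈ closure L := by
    intro x s t h hst
    have hmaps : MapsTo (fun p : Rn n × ℝ => p + ((0 : Rn n), t - s)) L L :=
      hLup _ (sub_nonneg.2 hst)
    have := hmaps.closure (by fun_prop) h
    simpa using this
  have hsub : ∀ k, epi (φ k) ⊆ epi (coneBound n R) := fun k =>
    epi_anti (coneBound_le (hφ k) hR (hRφ k))
  have hcone := coneBound_mem_cvx0 (n := n) hR
  have hLcone : closure L ⊆ epi (coneBound n R) := by
    refine closure_minimal (fun p hp => ?_) (isClosed_epi hcone.2.1)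
    obtain ⟨k, hk⟩ := hp.exists
    exact hsub _ hk
  have hL0 : ((0 : Rn n), (0 : ℝ)) ∈ closure L :=
    subset_closure (Eventually.of_forall fun k => by simp [epi, (hφ (g k)).2.2])
  have hψ := ofEpi_mem_cvx0 isClosed_closure hup hLconv.closure hL0
  have hepi := epi_ofEpi isClosed_closure hup fun p hp => (hLcone hp).2
  set ψ := ofEpi (closure L)
  refine ⟨ψ, hψ, g, hg, ?_⟩
  -- The frontier of a convex set is null; off it, membership in the epigraphs stabilizes.
  have hae : ∀ᵐ p ∂(volume : Measure (Rn n × ℝ)),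
      ∀ᶠ k in atTop, p ∈ epi (φ (g k)) ↔ p ∈ closure L := by
    have : (volume : Measure (Rn n × ℝ)).IsAddHaarMeasure :=
      inferInstanceAs ((volume : Measure (Rn n)).prod (volume : Measure ℝ)).IsAddHaarMeasure
    have hnull : (volume : Measure (Rn n × ℝ)) (frontier L) = 0 := hLconv.addHaar_frontier _
    rw [← compl_compl (frontier L)] at hnull
    filter_upwards [show (frontier L)ᶜ ∈ ae volume from hnull] with p hp
    by_cases hpc : p ∈ closure L
    · have hpi : p ∈ L := by
        by_contra hcon
        exact hp ⟨hpc, fun h => hcon (interior_subset h)⟩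
      filter_upwards [hpi] with k hk using ⟨fun _ => hpc, fun _ => hk⟩
    · filter_upwards [hlim p hpc] with k hk using ⟨fun h => absurd h hk, fun h => absurd h hpc⟩
  -- Dominated convergence, with the epigraph of `coneBound` as the dominating set.
  have hconv : ∀ w : ℝ → ℝ≥0∞, epiMeasure n w (epi (coneBound n R)) ≠ ∞ →
      Tendsto (fun k => epiMeasure n w (epi (φ (g k)))) atTop (𝓝 (epiMeasure n w (epi ψ))) := by
    intro w hfin
    refine tendsto_measure_of_ae_tendsto_indicator atTop (isClosed_epi hψ.2.1).measurableSet
      (fun k => (isClosed_epi (hφ (g k)).2.1).measurableSet)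
      (isClosed_epi hcone.2.1).measurableSet hfin (Eventually.of_forall fun k => hsub _) ?_
    rw [hepi]
    exact (epiMeasure_absolutelyContinuous n w).ae_le hae
  have hconeV := levelVol_coneBound_ne_top (n := n) hR
  have hden := hconv expWeight (by
    rw [epiMeasure_expWeight hcone]; exact expIntegral_ne_top hcone one_pos hconeV)
  have hnum := hconv (expInvWeight n) (by
    rw [epiMeasure_expInvWeight hcone]
    exact ne_top_of_le_ne_top (ENNReal.mul_ne_top ENNReal.ofReal_ne_top hconeV)
      (expIntegral_transformJ_le hcone one_pos))
  have hfin : ∀ χ ∈ Cvx0 n, (∀ x, coneBound n R x ≤ χ x) → levelVol χ 1 ≠ ∞ := by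
    intro χ _ h
    exact ne_top_of_le_ne_top hconeV (measure_mono fun x hx => (h x).trans hx)
  have hpos : ∀ χ : Rn n → ℝ≥0∞, (∀ x ∈ O, χ x ≤ 1) → levelVol χ 1 ≠ 0 := by
    intro χ h
    refine (lt_of_lt_of_le (hO.measure_pos volume hOne) (measure_mono fun x hx => ?_)).ne'
    simpa using h x hx
  have hψO : ∀ x ∈ O, ψ x ≤ 1 := by
    intro x hx
    have h1 : (x, (1 : ℝ)) ∈ closure L :=
      subset_closure (Eventually.of_forall fun k => ⟨by simpa using hOφ (g k) x hx, by simp⟩)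
    have := (ofEpi_le_iff isClosed_closure hup x zero_le_one).2 h1
    simpa using this
  have hψcone : ∀ x, coneBound n R x ≤ ψ x := by
    intro x
    by_cases hx : ψ x = ∞
    · simp [hx]
    have hmem : (x, (ψ x).toReal) ∈ epi ψ := epi_le_toReal hx
    rw [hepi] at hmem
    have := (hLcone hmem).1
    rwa [ENNReal.ofReal_toReal hx] at this
  simp_rw [epiMeasure_expWeight (hφ _)] at hden
  simp_rw [epiMeasure_expInvWeight (hφ _)] at hnum
  rw [epiMeasure_expWeight hψ] at hden
  rw [epiMeasure_expInvWeight hψ] at hnum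
  have hψ0 := hpos ψ hψO
  have hψ1 := hfin ψ hψ hψcone
  rw [sJ_eq_div hψ one_pos hψ0 hψ1]
  have heq : ∀ k, sJ (φ (g k)) = expIntegral (transformJ (φ (g k))) / expIntegral (φ (g k)) :=
    fun k => sJ_eq_div (hφ _) one_pos (hpos _ (hOφ _))
      (hfin _ (hφ _) (coneBound_le (hφ _) hR (hRφ _)))
  simp_rw [heq]
  exact ENNReal.Tendsto.div hnum (Or.inr (expIntegral_ne_zero hψ one_pos hψ0)) hden
    (Or.inr (ne_top_of_le_ne_top (ENNReal.mul_ne_top ENNReal.ofReal_ne_top hψ1)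
      (expIntegral_transformJ_le hψ one_pos)))

/-! ### Existence of a maximizer and the conclusion. -/

/-- Degenerate functions have value `1`, so a supremum above `1` makes a maximizing sequence
eventually non-degenerate, hence normalizable. -/
lemma exists_isMaxOn_sJ {φ₀ : Rn n → ℝ≥0∞} (hφ₀ : φ₀ ∈ Cvx0 n) (h : 1 < sJ φ₀) :
    ∃ φ ∈ Cvx0 n, ∀ ψ ∈ Cvx0 n, sJ ψ ≤ sJ φ := by
  set S := sSup (sJ '' Cvx0 n)
  have hS1 : 1 < S := h.trans_le (le_sSup ⟨φ₀, hφ₀, rfl⟩)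
  obtain ⟨u, -, hu, hmem⟩ := exists_seq_tendsto_sSup (S := sJ '' Cvx0 n) ⟨_, φ₀, hφ₀, rfl⟩
    (OrderTop.bddAbove _)
  obtain ⟨m, hm⟩ := eventually_atTop.1 (hu.eventually (lt_mem_nhds hS1))
  have hex : ∀ k, ∃ ψ ∈ Cvx0 n, sJ ψ = u (k + m) ∧
      (∀ x ∈ openSimplex n, ψ x ≤ 1) ∧ ∀ x, ψ x ≤ 1 → ‖x‖ ≤ 2 * n + 1 := by
    intro k
    obtain ⟨φ, hφ, hφu⟩ := hmem (k + m)
    have hgt : 1 < sJ φ := by rw [hφu]; exact hm _ (Nat.le_add_left m k)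
    rw [← hφu]
    exact exists_normalized hφ
      (fun h0 => hgt.ne' (sJ_eq_one_of_levelVol_eq_zero hφ one_pos h0))
      (fun h1 => hgt.ne' (sJ_eq_one_of_levelVol_eq_top hφ h1))
  choose ψ hψ hψu hψO hψR using hex
  obtain ⟨χ, hχ, g, hg, hlim⟩ := exists_limit hψ isOpen_openSimplex openSimplex_nonempty hψO
    (by positivity) hψR
  refine ⟨χ, hχ, fun η hη => ?_⟩
  have hlim2 : Tendsto (fun k => sJ (ψ (g k))) atTop (𝓝 S) := by
    simp_rw [hψu]
    exact (hu.comp (tendsto_add_atTop_nat m)).comp hg.tendsto_atTop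
  rw [tendsto_nhds_unique hlim hlim2]
  exact le_sSup ⟨η, hη, rfl⟩

theorem theorem2 :
    ∃ c C : ℝ, 0 < c ∧ 0 < C ∧ ∃ N : ℕ, ∀ n : ℕ, N ≤ n →
      ∃ M : ℝ, IsGreatest (sJ '' Cvx0 n) (ENNReal.ofReal M) ∧
        (1 + c / (n : ℝ)) * (n.factorial : ℝ) ≤ M ∧ M ≤ (1 + C / (n : ℝ)) * (n.factorial : ℝ) := by
  refine ⟨1 / 16, 35, by norm_num, by norm_num, 8, fun n hn => ?_⟩
  obtain ⟨φ₀, hφ₀, hlow⟩ := exists_le_sJ hn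
  have hf : (1 : ℝ) ≤ n.factorial := by exact_mod_cast n.factorial_pos
  have hn0 : (0 : ℝ) < n := by exact_mod_cast (by omega : 0 < n)
  have h1 : 1 < sJ φ₀ := by
    refine lt_of_lt_of_le ?_ hlow
    rw [ENNReal.one_lt_ofReal]
    nlinarith [show 0 < (1 / 16) / (n : ℝ) by positivity]
  obtain ⟨φ, hφ, hmax⟩ := exists_isMaxOn_sJ hφ₀ h1
  have hup := sJ_le hφ (by omega)
  have hfin : sJ φ ≠ ∞ := ne_top_of_le_ne_top ENNReal.ofReal_ne_top hup
  refine ⟨(sJ φ).toReal, ?_, ?_, ?_⟩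
  · rw [ENNReal.ofReal_toReal hfin]
    refine ⟨⟨φ, hφ, rfl⟩, ?_⟩
    rintro _ ⟨ψ, hψ, rfl⟩
    exact hmax ψ hψ
  · exact (ENNReal.ofReal_le_iff_le_toReal hfin).1 (hlow.trans (hmax φ₀ hφ₀))
  · exact ENNReal.toReal_le_of_le_ofReal (by positivity) hup
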